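/- For a finite set $F\subseteq\mathbb{Z}^2$ and a direction $s\in\mathbb{R}^2\setminus\{0\}$, the X-ray of $F$ in direction $s$ gives the number of points of $F$ on each line parallel to $s$. Let $\psi_{\mathbb{Z}^2}(m)$ be the minimum number $n$ for which there exist $m$ directions $s_1,\dots,s_m$, pairwise linearly independent and spanning $\mathbb{R}^2$, and two different $n$-point sets in $\mathbb{Z}^2$ that have the same X-rays in all of these directions. If $m=5$ or $m>6$, then this minimum exists and $\psi_{\mathbb{Z}^2}(m)\geq m+1$. In other words, if $m=5$ or $m>6$, then two different subsets of $\mathbb{Z}^2$ of the same finite size $n\leq m$ cannot have equal X-rays in $m$ pairwise linearly independent directions. -/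

import Mathlib

/-- The (discrete) X-ray of the finite set `F ⊆ ℝ^d` in direction `s`: it gives, for every line
parallel to `s`, the number of points of `F` on that line. The line is named by any point `x` on
it, that is, it is the line `{x + t s : t ∈ ℝ}`. -/
noncomputable def xray {d : ℕ} (F : Finset (Fin d → ℝ)) (s : Fin d → ℝ) (x : Fin d → ℝ) : ℕ :=
  {p : Fin d → ℝ | p ∈ F ∧ ∃ t : ℝ, p = x + t • s}.ncard

/-- All points of `F` lie in `K^d`, where `K ⊆ ℝ`. -/
def PointsIn (K : Set ℝ) {d : ℕ} (F : Finset (Fin d → ℝ)) : Prop :=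
  ∀ p ∈ F, ∀ i, p i ∈ K

/-- The vectors `s 0, …, s (m - 1)` are pairwise linearly independent (in particular they are
nonzero as soon as there are two of them). -/
def PairwiseIndependent {d m : ℕ} (s : Fin m → Fin d → ℝ) : Prop :=
  ∀ i j, i ≠ j → LinearIndependent ℝ ![s i, s j]

/-- The set of all `n` for which there are `m` directions, pairwise linearly independent and
spanning `ℝ^d`, and two different `n`-point sets in `K^d` that have the same X-rays in these
directions. -/
def switchingSizes (K : Set ℝ) (d m : ℕ) : Set ℕ :=
  {n | ∃ s : Fin m → Fin d → ℝ, PairwiseIndependent s ∧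
    Submodule.span ℝ (Set.range s) = ⊤ ∧
    ∃ F F' : Finset (Fin d → ℝ), PointsIn K F ∧ PointsIn K F' ∧
      F.card = n ∧ F'.card = n ∧ F ≠ F' ∧ ∀ i, xray F (s i) = xray F' (s i)}

/-- `ψ_{K^d}(m)`: the minimum of `switchingSizes K d m` (a genuine minimum when that set is
nonempty). -/
noncomputable def psi (K : Set ℝ) (d m : ℕ) : ℕ := sInf (switchingSizes K d m)

/-- The integers as a subset of the reals. -/
def intSet : Set ℝ := Set.range (fun z : ℤ => (z : ℝ))

/-! Delete the common points, so that the two sets `F`, `F'` are disjoint. Each of the `m` lines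
through a point of `F` contains a point of `F'`, and different lines give different points, so both
sets have at least `m` points. If they have no more, everything is tight (`IsTightSwitching`): a
line that meets the sets carries one point of each, and every line joining `F` to `F'` has a given
direction.

Tightness makes the lowest points for consecutive angles the vertices of a `2m`-gon whose edges run
through the directions, and the chords parallel to an edge pair the vertices on its two sides
(`IsTightSwitching.exists_isPairedPolygon`). This is as rigid as an affinely regular polygon: if `W
k` is the step from vertex `2k` to vertex `2k + 2`, the determinant of `W a` and `W b` depends only
on `b - a` (`planeDet_shift`). Hence `D (W (k+2) + W k) = E W (k+1)` with integers `D > 0` and `E`.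

Now the crystallographic restriction applies. As `W` is integral and periodic, `E / D` is an integer
in `[-2, 2]`, so the polygon returns to its starting vertex after `2r` steps with `r` one of 1, 2,
3, 4, 6. The vertices are distinct, which leaves only `m = 6` (`IsPairedPolygon.eq_six`).

That the minimum exists is a separate matter: project an `m`-cube to the lattice and split its
vertices by parity (`switchingSizes_intSet_two_nonempty`). -/

/-! ### Linear forms attached to angles, and cyclic families of angles. -/

/-- The cross product of the unit vector at angle `θ` with `p`; its level sets are the lines
in direction `θ`. -/
noncomputable def sideForm (θ : ℝ) (p : ℤ × ℤ) : ℝ := Real.cos θ * p.2 - Real.sin θ * p.1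

theorem sideForm_sub (θ : ℝ) (p q : ℤ × ℤ) :
    sideForm θ (p - q) = sideForm θ p - sideForm θ q := by
  simp only [sideForm, Prod.fst_sub, Prod.snd_sub]; push_cast; ring

theorem sideForm_add_pi (θ : ℝ) (p : ℤ × ℤ) : sideForm (θ + Real.pi) p = -sideForm θ p := by
  simp only [sideForm, Real.cos_add_pi, Real.sin_add_pi]; ring

/-- Three linear forms on the plane are dependent. With the signs of the sines known, two values of
the forms constrain the sign of the third. -/
theorem sideForm_three_term (a b c : ℝ) (p : ℤ × ℤ) :
    Real.sin (c - b) * sideForm a p + Real.sin (a - c) * sideForm b p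
      + Real.sin (b - a) * sideForm c p = 0 := by
  simp only [sideForm, Real.sin_sub]; ring

theorem eq_of_sideForm_eq {a b : ℝ} (hab : Real.sin (b - a) ≠ 0) {p q : ℤ × ℤ}
    (ha : sideForm a p = sideForm a q) (hb : sideForm b p = sideForm b q) : p = q := by
  simp only [sideForm] at ha hb
  rw [Real.sin_sub] at hab
  have h1 : (p.1 : ℝ) = q.1 := by
    apply mul_left_cancel₀ hab
    linear_combination Real.cos b * ha - Real.cos a * hb
  have h2 : (p.2 : ℝ) = q.2 := by
    apply mul_left_cancel₀ hab
    linear_combination Real.sin b * ha - Real.sin a * hb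
  exact Prod.ext (by exact_mod_cast h1) (by exact_mod_cast h2)

/-- The determinant of two integer vectors. -/
def planeDet (p q : ℤ × ℤ) : ℤ := p.1 * q.2 - p.2 * q.1

theorem sideForm_mul_sub_mul (a b : ℝ) (p q : ℤ × ℤ) :
    sideForm a p * sideForm b q - sideForm b p * sideForm a q
      = Real.sin (b - a) * (planeDet q p : ℝ) * (-1) := by
  simp only [sideForm, Real.sin_sub, planeDet]; push_cast; ring

/-- `z` is a lowest point of `G` with respect to `sideForm t`. -/
def IsLowest (G : Finset (ℤ × ℤ)) (t : ℝ) (z : ℤ × ℤ) : Prop :=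
  z ∈ G ∧ ∀ w ∈ G, sideForm t z ≤ sideForm t w

/-- An increasing family of angles running through `m` directions in each half turn. -/
structure IsAngleFamily (m : ℕ) (θ : ℤ → ℝ) : Prop where
  strictMono : StrictMono θ
  add_period : ∀ i, θ (i + m) = θ i + Real.pi

namespace IsAngleFamily

variable {m : ℕ} {θ : ℤ → ℝ}

theorem sin_pos (h : IsAngleFamily m θ) {i k : ℤ} (h1 : i < k) (h2 : k < i + m) :
    0 < Real.sin (θ k - θ i) := by
  have := h.strictMono h1
  have h3 := h.strictMono h2
  rw [h.add_period] at h3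
  exact Real.sin_pos_of_pos_of_lt_pi (by linarith) (by linarith)

theorem sideForm_add (h : IsAngleFamily m θ) (i : ℤ) (p : ℤ × ℤ) :
    sideForm (θ (i + m)) p = -sideForm (θ i) p := by
  rw [h.add_period, sideForm_add_pi]

theorem sideForm_add_two_mul (h : IsAngleFamily m θ) (i : ℤ) (p : ℤ × ℤ) :
    sideForm (θ (i + 2 * m)) p = sideForm (θ i) p := by
  rw [two_mul, ← add_assoc, h.sideForm_add, h.sideForm_add, neg_neg]

theorem tie_add_mul (h : IsAngleFamily m θ) (i n : ℤ) (p q : ℤ × ℤ) :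
    sideForm (θ (i + n * m)) p = sideForm (θ (i + n * m)) q ↔
      sideForm (θ i) p = sideForm (θ i) q := by
  induction n using Int.induction_on with
  | zero => simp
  | succ k ih =>
    rw [← ih, show i + ((k : ℤ) + 1) * m = i + (k : ℤ) * m + m by ring, h.sideForm_add,
      h.sideForm_add, neg_inj]
  | pred k ih =>
    rw [← ih, show i + (-(k : ℤ)) * m = i + (-(k : ℤ) - 1) * m + m by ring, h.sideForm_add,
      h.sideForm_add, neg_inj]

theorem tie_emod (h : IsAngleFamily m θ) (i j : ℤ) (p q : ℤ × ℤ) :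
    sideForm (θ (j + (i - j) % m)) p = sideForm (θ (j + (i - j) % m)) q ↔
      sideForm (θ i) p = sideForm (θ i) q := by
  rw [← h.tie_add_mul (j + (i - j) % m) ((i - j) / m)]
  rw [show j + (i - j) % m + (i - j) / m * m = i by
    linarith [Int.emod_add_mul_ediv (i - j) m, mul_comm ((m : ℤ)) ((i - j) / m)]]

end IsAngleFamily

/-! ### Tight switchings and their lowest points. -/

/-- Two disjoint `m`-point sets such that every line in one of the directions `θ i` which meets
one of them contains exactly one point of each, and such that every line joining a point of one
to a point of the other has one of these directions. -/
structure IsTightSwitching (m : ℕ) (θ : ℤ → ℝ) (F F' : Finset (ℤ × ℤ)) : Prop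
    extends IsAngleFamily m θ where
  four_lt : 4 < m
  disjoint : Disjoint F F'
  card_left : F.card = m
  card_right : F'.card = m
  exists_right : ∀ i, ∀ p ∈ F, ∃ q ∈ F', sideForm (θ i) q = sideForm (θ i) p
  exists_left : ∀ i, ∀ q ∈ F', ∃ p ∈ F, sideForm (θ i) p = sideForm (θ i) q
  inj_left : ∀ i, Set.InjOn (sideForm (θ i)) F
  inj_right : ∀ i, Set.InjOn (sideForm (θ i)) F'
  cover : ∀ p ∈ F, ∀ q ∈ F', ∃ i, sideForm (θ i) p = sideForm (θ i) q

namespace IsTightSwitching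

variable {m : ℕ} {θ : ℤ → ℝ} {F F' : Finset (ℤ × ℤ)}

theorem symm (h : IsTightSwitching m θ F F') : IsTightSwitching m θ F' F where
  strictMono := h.strictMono
  add_period := h.add_period
  four_lt := h.four_lt
  disjoint := h.disjoint.symm
  card_left := h.card_right
  card_right := h.card_left
  exists_right := h.exists_left
  exists_left := h.exists_right
  inj_left := h.inj_right
  inj_right := h.inj_left
  cover := fun p hp q hq => (h.cover q hq p hp).imp fun _ => Eq.symm

theorem exists_lowest_pair (h : IsTightSwitching m θ F F') (i : ℤ) :
    ∃ p ∈ F, ∃ q ∈ F', sideForm (θ i) p = sideForm (θ i) q ∧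
      IsLowest (F ∪ F') (θ i) p ∧ IsLowest (F ∪ F') (θ i) q := by
  have hne : F.Nonempty := by
    rw [← Finset.card_pos, h.card_left]; have := h.four_lt; omega
  obtain ⟨p, hp, hmin⟩ := F.exists_min_image (sideForm (θ i)) hne
  obtain ⟨q, hq, hqp⟩ := h.exists_right i p hp
  have key : ∀ w ∈ F ∪ F', sideForm (θ i) p ≤ sideForm (θ i) w := by
    intro w hw
    rcases Finset.mem_union.1 hw with hw | hw
    · exact hmin w hw
    · obtain ⟨w', hw', e⟩ := h.exists_left i w hw
      rw [← e]; exact hmin w' hw'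
  exact ⟨p, hp, q, hq, hqp.symm, ⟨Finset.mem_union_left _ hp, key⟩,
    ⟨Finset.mem_union_right _ hq, fun w hw => hqp.trans_le (key w hw)⟩⟩

/-- If some `w ∈ F` were lower than `q` at the next angle, then `w - q` would point strictly between
two consecutive angles, whereas `cover` gives it one of the angles of the family. -/
theorem isLowest_succ (h : IsTightSwitching m θ F F') {i : ℤ} {p q : ℤ × ℤ} (hp : p ∈ F)
    (hq : q ∈ F') (htie : sideForm (θ i) p = sideForm (θ i) q)
    (hlow : IsLowest (F ∪ F') (θ i) q)
    (hlt : sideForm (θ (i + 1)) q < sideForm (θ (i + 1)) p) :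
    IsLowest (F ∪ F') (θ (i + 1)) q := by
  have hm := h.four_lt
  have key : ∀ w ∈ F, sideForm (θ (i + 1)) q ≤ sideForm (θ (i + 1)) w := by
    intro w hw
    by_contra! hcon
    have h1 : sideForm (θ i) q < sideForm (θ i) w := by
      refine lt_of_le_of_ne (hlow.2 w (Finset.mem_union_left _ hw)) fun e => ?_
      have := h.inj_left i hp hw (htie.trans e)
      subst this; exact lt_asymm hlt hcon
    obtain ⟨k₀, hk₀⟩ := h.cover w hw q hq
    -- Choose the representative of the direction in the range from `i + 1` to `i + m`, where the
    -- signs of both sines are known.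
    rw [← h.tie_emod k₀ (i + 1)] at hk₀
    have hr0 := Int.emod_nonneg (k₀ - (i + 1)) (b := (m : ℤ)) (by omega)
    have hr1 := Int.emod_lt_of_pos (k₀ - (i + 1)) (b := (m : ℤ)) (by omega)
    generalize (k₀ - (i + 1)) % (m : ℤ) = r at hk₀ hr0 hr1
    have e := sideForm_three_term (θ i) (θ (i + 1)) (θ (i + 1 + r)) (w - q)
    rw [show Real.sin (θ i - θ (i + 1 + r)) = -Real.sin (θ (i + 1 + r) - θ i) by
      rw [← Real.sin_neg, neg_sub]] at e
    simp only [sideForm_sub] at e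
    rw [hk₀] at e
    rcases eq_or_lt_of_le hr0 with hr | hr
    · subst hr
      have := h.sin_pos (i := i) (k := i + 1) (by omega) (by omega)
      simp only [add_zero, sub_self, Real.sin_zero] at e
      nlinarith
    · have s1 := h.sin_pos (i := i + 1) (k := i + 1 + r) (by omega) (by omega)
      have s2 : 0 ≤ Real.sin (θ (i + 1 + r) - θ i) := by
        rcases eq_or_lt_of_le (show i + 1 + r ≤ i + m by omega) with e | e
        · rw [e, h.add_period]; simp
        · exact (h.sin_pos (by omega) e).le
      nlinarith [mul_pos s1 (sub_pos.2 h1), mul_nonneg s2 (sub_pos.2 hcon).le]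
  refine ⟨Finset.mem_union_right _ hq, fun w hw => ?_⟩
  rcases Finset.mem_union.1 hw with hw | hw
  · exact key w hw
  · obtain ⟨w', hw', e⟩ := h.exists_left (i + 1) w hw
    rw [← e]; exact key w' hw'

theorem exists_common_lowest (h : IsTightSwitching m θ F F') (i : ℤ) :
    ∃ z, IsLowest (F ∪ F') (θ i) z ∧ IsLowest (F ∪ F') (θ (i + 1)) z := by
  have hm := h.four_lt
  obtain ⟨p, hp, q, hq, e, lp, lq⟩ := h.exists_lowest_pair i
  rcases lt_trichotomy (sideForm (θ (i + 1)) q) (sideForm (θ (i + 1)) p) with hlt | heq | hlt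
  · exact ⟨q, lq, h.isLowest_succ hp hq e lq hlt⟩
  · have := eq_of_sideForm_eq (h.sin_pos (i := i) (k := i + 1) (by omega) (by omega)).ne' e heq.symm
    subst this
    exact absurd hq (Finset.disjoint_left.1 h.disjoint hp)
  · refine ⟨p, lp, ?_⟩
    have := h.symm.isLowest_succ hq hp e.symm (by rwa [Finset.union_comm]) hlt
    rwa [Finset.union_comm]

end IsTightSwitching

theorem IsLowest.sideForm_eq {G : Finset (ℤ × ℤ)} {t : ℝ} {z w : ℤ × ℤ} (hz : IsLowest G t z)
    (hw : IsLowest G t w) : sideForm t z = sideForm t w :=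
  le_antisymm (hz.2 w hw.1) (hw.2 z hz.1)

/-! ### The polygon of lowest points. -/

/-- `z` lists the vertices of a polygon whose edges have the directions `θ i`, and in each of these
directions the vertices are paired symmetrically. -/
structure IsPairedPolygon (m : ℕ) (θ : ℤ → ℝ) (z : ℤ → ℤ × ℤ) : Prop
    extends IsAngleFamily m θ where
  four_lt : 4 < m
  periodic : ∀ i, z (i + 2 * m) = z i
  edge : ∀ k, ∃ t : ℝ, 0 < t ∧ (((z k).1 : ℝ) - (z (k - 1)).1 = t * Real.cos (θ k)) ∧
    (((z k).2 : ℝ) - (z (k - 1)).2 = t * Real.sin (θ k))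
  paired : ∀ i a b, a + b = 2 * i - 1 → sideForm (θ i) (z a) = sideForm (θ i) (z b)

theorem sideForm_sub_of_edge {i k : ℝ} {p q : ℤ × ℤ} {t : ℝ}
    (h1 : (p.1 : ℝ) - q.1 = t * Real.cos k) (h2 : (p.2 : ℝ) - q.2 = t * Real.sin k) :
    sideForm i p - sideForm i q = t * Real.sin (k - i) := by
  simp only [sideForm, Real.sin_sub]
  linear_combination Real.cos i * h2 - Real.sin i * h1

theorem exists_edge_of_sideForm {j k : ℝ} {p q : ℤ × ℤ} (hs : 0 < Real.sin (k - j))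
    (h0 : sideForm k p = sideForm k q) (hj : sideForm j q < sideForm j p) :
    ∃ t : ℝ, 0 < t ∧ ((p.1 : ℝ) - q.1 = t * Real.cos k) ∧ ((p.2 : ℝ) - q.2 = t * Real.sin k) := by
  refine ⟨(sideForm j p - sideForm j q) / Real.sin (k - j), div_pos (sub_pos.2 hj) hs, ?_, ?_⟩
  all_goals
    rw [div_mul_eq_mul_div, eq_div_iff hs.ne']
    simp only [sideForm, Real.sin_sub] at *
  · linear_combination -Real.cos j * h0
  · linear_combination -Real.sin j * h0

theorem strictMono_fin_of_lt_succ {m : ℕ} {f : ℤ → ℝ}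
    (hf : ∀ j : ℤ, 0 ≤ j → j + 1 < m → f j < f (j + 1)) :
    StrictMono fun j : Fin m => f (j : ℕ) := by
  have key : ∀ d a : ℕ, a + d + 1 < m → f a < f ((a + d + 1 : ℕ) : ℤ) := by
    intro d
    induction d with
    | zero => intro a ha; exact_mod_cast hf a (by omega) (by omega)
    | succ d ih =>
      intro a ha
      refine (ih a (by omega)).trans ?_
      have := hf ((a + d + 1 : ℕ) : ℤ) (by omega) (by omega)
      rw [show ((a + (d + 1) + 1 : ℕ) : ℤ) = ((a + d + 1 : ℕ) : ℤ) + 1 by push_cast; ring]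
      exact this
  intro a b hab
  have h1 : (a : ℕ) < b := hab
  obtain ⟨d, hd⟩ := Nat.exists_eq_add_of_lt h1
  have := key d a (by have := b.2; omega)
  simp only [hd]; exact this

/-- The vertex `z i` is a point that is lowest at both `θ i` and `θ (i + 1)`. The pairing comes from
counting levels: there are exactly `m` of them in each direction. -/
theorem IsTightSwitching.exists_isPairedPolygon {m : ℕ} {θ : ℤ → ℝ} {F F' : Finset (ℤ × ℤ)}
    (h : IsTightSwitching m θ F F') : ∃ z, IsPairedPolygon m θ z := by
  have hm := h.four_lt
  choose z hz1 hz2 using h.exists_common_lowest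
  have hz2' : ∀ k, IsLowest (F ∪ F') (θ k) (z (k - 1)) := fun k => by
    have := hz2 (k - 1); rwa [sub_add_cancel] at this
  have hper : ∀ i, z (i + 2 * m) = z i := by
    intro i
    have low : ∀ i w, IsLowest (F ∪ F') (θ (i + 2 * m)) w → IsLowest (F ∪ F') (θ i) w := by
      intro i w hw
      refine ⟨hw.1, fun x hx => ?_⟩
      simpa only [h.sideForm_add_two_mul] using hw.2 x hx
    refine eq_of_sideForm_eq (h.sin_pos (i := i) (k := i + 1) (by omega) (by omega)).ne'
      ((low _ _ (hz1 _)).sideForm_eq (hz1 i)) ((low (i + 1) _ ?_).sideForm_eq (hz2 i))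
    rw [show i + 1 + 2 * (m : ℤ) = i + 2 * m + 1 by ring]
    exact hz2 _
  -- Otherwise `z k` is lowest at three consecutive angles. At the middle one there is a second
  -- lowest point `w`, and the three-term relation forces `w = z k`.
  have hne : ∀ k, z k ≠ z (k - 1) := by
    intro k e
    obtain ⟨p, hp, q, hq, etie, lp, lq⟩ := h.exists_lowest_pair k
    obtain ⟨w, hw, lw⟩ : ∃ w, w ≠ z k ∧ IsLowest (F ∪ F') (θ k) w := by
      by_cases hpz : p = z k
      · refine ⟨q, fun hqz => ?_, lq⟩
        exact Finset.disjoint_left.1 h.disjoint hp (by rw [hpz, ← hqz]; exact hq)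
      · exact ⟨p, hpz, lp⟩
    have l1 : IsLowest (F ∪ F') (θ (k - 1)) (z k) := by rw [e]; exact hz1 _
    have a1 := l1.2 w lw.1
    have a2 := (hz2 k).2 w lw.1
    have a3 := lw.sideForm_eq (hz1 k)
    have e3 := sideForm_three_term (θ (k - 1)) (θ k) (θ (k + 1)) (w - z k)
    simp only [sideForm_sub, a3] at e3
    have s1 := h.sin_pos (i := k) (k := k + 1) (by omega) (by omega)
    have s2 := h.sin_pos (i := k - 1) (k := k) (by omega) (by omega)
    have b1 : sideForm (θ (k + 1)) w = sideForm (θ (k + 1)) (z k) := by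
      refine le_antisymm ?_ a2
      nlinarith [mul_nonneg s1.le (sub_nonneg.2 a1)]
    exact hw (eq_of_sideForm_eq s1.ne' a3 b1)
  have hedge : ∀ k, ∃ t : ℝ, 0 < t ∧ (((z k).1 : ℝ) - (z (k - 1)).1 = t * Real.cos (θ k)) ∧
      (((z k).2 : ℝ) - (z (k - 1)).2 = t * Real.sin (θ k)) := by
    intro k
    have s2 := h.sin_pos (i := k - 1) (k := k) (by omega) (by omega)
    have e0 := (hz1 k).sideForm_eq (hz2' k)
    refine exists_edge_of_sideForm s2 e0
      (lt_of_le_of_ne ((hz1 (k - 1)).2 _ (hz1 k).1) fun e => hne k ?_)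
    exact eq_of_sideForm_eq s2.ne' e.symm e0
  have hup : ∀ i k : ℤ, i < k → k < i + m → sideForm (θ i) (z (k - 1)) < sideForm (θ i) (z k) := by
    intro i k h1 h2
    obtain ⟨t, ht, e1, e2⟩ := hedge k
    have := sideForm_sub_of_edge (i := θ i) e1 e2
    have s := mul_pos ht (h.sin_pos h1 h2)
    linarith
  have hdown : ∀ i k : ℤ, i - m < k → k < i → sideForm (θ i) (z k) < sideForm (θ i) (z (k - 1)) := by
    intro i k h1 h2
    obtain ⟨t, ht, e1, e2⟩ := hedge k
    have := sideForm_sub_of_edge (i := θ i) e1 e2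
    have s := mul_pos ht (h.sin_pos h2 (by omega))
    rw [← neg_sub (θ k), Real.sin_neg] at s
    linarith
  -- The chains `z i, z (i + 1), …` and `z (i - 1), z (i - 2), …` both climb strictly through `m`
  -- values among the `m` levels of `F`. So both list all levels in increasing order, and their
  -- `j`-th terms agree.
  have hpair0 : ∀ i j : ℤ, 0 ≤ j → j < m →
      sideForm (θ i) (z (i + j)) = sideForm (θ i) (z (i - 1 - j)) := by
    intro i j hj0 hjm
    have hcard : (F.image (sideForm (θ i))).card = m := by
      rw [Finset.card_image_of_injOn (h.inj_left i), h.card_left]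
    have hmem : ∀ a, sideForm (θ i) (z a) ∈ F.image (sideForm (θ i)) := by
      intro a
      rcases Finset.mem_union.1 (hz1 a).1 with hw | hw
      · exact Finset.mem_image_of_mem _ hw
      · obtain ⟨w', hw', e⟩ := h.exists_left i _ hw
        rw [← e]; exact Finset.mem_image_of_mem _ hw'
    have m1 := strictMono_fin_of_lt_succ (m := m) (f := fun j => sideForm (θ i) (z (i + j)))
      (fun j h0 h1 => by
        have := hup i (i + (j + 1)) (by omega) (by omega)
        rwa [show i + (j + 1) - 1 = i + j by ring] at this)
    have m2 := strictMono_fin_of_lt_succ (m := m) (f := fun j => sideForm (θ i) (z (i - 1 - j)))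
      (fun j h0 h1 => by
        have := hdown i (i - 1 - j) (by omega) (by omega)
        rwa [show i - 1 - j - 1 = i - 1 - (j + 1) by ring] at this)
    have e1 := Finset.orderEmbOfFin_unique hcard (fun x => hmem _) m1
    have e2 := Finset.orderEmbOfFin_unique hcard (fun x => hmem _) m2
    have e3 := congrFun (e1.trans e2.symm) ⟨j.toNat, by omega⟩
    simpa [Int.toNat_of_nonneg hj0] using e3
  have hperZ : ∀ (n a : ℤ), z (a + n * (2 * m)) = z a := by
    intro n a
    induction n using Int.induction_on with
    | zero => simp
    | succ k ih => rw [← ih, ← hper (a + k * (2 * m))]; congr 1; ring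
    | pred k ih => rw [← ih, ← hper (a + (-(k : ℤ) - 1) * (2 * m))]; congr 1; ring
  refine ⟨z, ⟨⟨h.strictMono, h.add_period⟩, hm, hper, hedge, ?_⟩⟩
  intro i a b hab
  have r0 := Int.emod_nonneg (a - i) (b := 2 * (m : ℤ)) (by omega)
  have r1 := Int.emod_lt_of_pos (a - i) (b := 2 * (m : ℤ)) (by omega)
  have r2 := Int.emod_add_mul_ediv (a - i) (2 * m)
  generalize (a - i) % (2 * (m : ℤ)) = r at r0 r1 r2
  generalize (a - i) / (2 * (m : ℤ)) = n at r2
  by_cases hr : r < m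
  · have e := hpair0 i r r0 hr
    rw [← hperZ n (i + r), ← hperZ (-n) (i - 1 - r)] at e
    rw [show a = i + r + n * (2 * m) by linarith,
      show b = i - 1 - r + -n * (2 * m) by linarith]
    exact e
  -- Here `b` instead of `a` lies on the chain starting at `z i`.
  · have e := hpair0 i (2 * m - 1 - r) (by omega) (by omega)
    rw [← hperZ (-n - 1) (i + (2 * m - 1 - r)), ← hperZ (n + 1) (i - 1 - (2 * m - 1 - r))] at e
    rw [show a = i - 1 - (2 * m - 1 - r) + (n + 1) * (2 * m) by linarith,
      show b = i + (2 * m - 1 - r) + (-n - 1) * (2 * m) by linarith]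
    exact e.symm

/-! ### Integer sequences with a symmetric three-term recurrence. -/

/-- With `p / q` in lowest terms, the recurrence shows inductively that every power of the
denominator divides every term. A nonzero term then makes the denominator a unit. -/
theorem dvd_of_recurrence {x : ℤ → ℤ} {p q : ℤ} (hq : q ≠ 0)
    (hx : ∀ k, q * (x (k + 2) + x k) = p * x (k + 1)) {k₀ : ℤ} (h0 : x k₀ ≠ 0) : q ∣ p := by
  obtain ⟨g, q', p', hg, hcop, rfl, rfl⟩ := Int.exists_gcd_one' (m := q) (n := p)
    (Int.gcd_pos_of_ne_zero_left _ hq)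
  have hg' : (g : ℤ) ≠ 0 := by exact_mod_cast hg.ne'
  have hx' : ∀ k, q' * (x (k + 2) + x k) = p' * x (k + 1) := fun k =>
    mul_right_cancel₀ hg' (by linear_combination hx k)
  have hpow : ∀ N : ℕ, ∀ k, q' ^ N ∣ x k := by
    intro N
    induction N with
    | zero => intro k; simp
    | succ N ih =>
      intro k
      have h1 : q' ^ (N + 1) ∣ p' * x k := by
        have e := hx' (k - 1)
        rw [show k - 1 + 1 = k by ring] at e
        rw [← e, pow_succ']
        exact mul_dvd_mul_left _ (dvd_add (ih _) (ih _))
      exact (IsCoprime.pow_left (Int.isCoprime_iff_gcd_eq_one.2 hcop)).dvd_of_dvd_mul_left h1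
  have hunit : IsUnit q' := by
    by_contra hu
    have hf : FiniteMultiplicity q' (x k₀) :=
      Int.finiteMultiplicity_iff.2 ⟨fun h => hu (Int.isUnit_iff_natAbs_eq.2 h), h0⟩
    obtain ⟨n, hn⟩ := hf
    exact hn (hpow _ _)
  exact mul_dvd_mul_right hunit.dvd _

/-- Apply the recurrence around a term of largest absolute value, which exists by periodicity. -/
theorem abs_le_two_of_recurrence {x : ℤ → ℤ} {τ : ℤ} {m : ℕ} (hm : 0 < m)
    (hx : ∀ k, x (k + 2) + x k = τ * x (k + 1)) (hper : ∀ k, x (k + m) = x k)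
    {k₀ : ℤ} (h0 : x k₀ ≠ 0) : |τ| ≤ 2 := by
  obtain ⟨K, -, hK⟩ := (Finset.range m).exists_max_image (fun k : ℕ => |x k|)
    ⟨0, Finset.mem_range.2 hm⟩
  have hperZ : ∀ (n k : ℤ), x (k + n * m) = x k := by
    intro n k
    induction n using Int.induction_on with
    | zero => simp
    | succ j ih => rw [← ih, ← hper (k + j * m)]; congr 1; ring
    | pred j ih => rw [← ih, ← hper (k + (-(j : ℤ) - 1) * m)]; congr 1; ring
  have hmax : ∀ k, |x k| ≤ |x K| := by
    intro k
    have r0 := Int.emod_nonneg k (b := (m : ℤ)) (by omega)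
    have r1 := Int.emod_lt_of_pos k (b := (m : ℤ)) (by omega)
    have r2 := Int.emod_add_mul_ediv k m
    have := hK (k % m).toNat (Finset.mem_range.2 (by omega))
    rw [Int.toNat_of_nonneg r0] at this
    rwa [← hperZ (k / m) (k % m), mul_comm, r2] at this
  have hpos : 0 < |x K| := (abs_pos.2 h0).trans_le (hmax k₀)
  have e := hx (K - 1)
  rw [show (K : ℤ) - 1 + 1 = K by ring] at e
  have h1 : |τ| * |x K| ≤ 2 * |x K| := by
    rw [← abs_mul, ← e, two_mul]
    exact (abs_add_le _ _).trans (add_le_add (hmax _) (hmax _))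
  exact le_of_mul_le_mul_right h1 hpos

/-- The possible periods of a periodic integer sequence whose differences satisfy
`w (k + 2) + w k = τ * w (k + 1)`. -/
theorem exists_period_of_recurrence {τ : ℤ} (hτ : |τ| ≤ 2) {m : ℕ} (hm : 0 < m) :
    ∃ r ∈ ({1, 2, 3, 4, 6} : Finset ℕ), ∀ z : ℤ → ℤ, (∀ k, z (k + m) = z k) →
      (∀ k, (z (k + 3) - z (k + 2)) + (z (k + 1) - z k) = τ * (z (k + 2) - z (k + 1))) →
      z r = z 0 := by
  have hm' : (m : ℤ) ≠ 0 := by exact_mod_cast hm.ne'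
  obtain ⟨h1, h2⟩ := abs_le.1 hτ
  interval_cases τ
  · refine ⟨2, by simp, fun z hper hz => ?_⟩
    -- Double characteristic root -1: the even terms form an arithmetic progression, whose step
    -- vanishes by periodicity.
    have key : ∀ n : ℕ, z (2 * n) = z 0 + n * (z 2 - z 0) ∧
        z (2 * n + 1) = z 1 - n * (z 2 - z 0) := by
      intro n
      induction n with
      | zero => simp
      | succ n ih =>
        have alt : ∀ n : ℕ, z (2 * n + 2) - z (2 * n) = z 2 - z 0 := by
          intro n
          induction n with
          | zero => simp
          | succ n ih =>
            have a := hz (2 * n)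
            have b := hz (2 * n + 1)
            push_cast
            ring_nf at a b ih ⊢
            linarith
        have a := hz (2 * n)
        have b := alt n
        push_cast
        ring_nf at a b ih ⊢
        constructor <;> linarith [ih.1, ih.2]
    have e := (key m).1
    rw [two_mul, hper, show z m = z 0 by simpa using hper 0] at e
    have : (m : ℤ) * (z 2 - z 0) = 0 := by linarith
    have := (mul_eq_zero.1 this).resolve_left hm'
    push_cast; linarith
  -- For `τ = -1, 0, 1` the characteristic roots are primitive roots of unity of order 3, 4, 6. As 1
  -- is not a root, the differences sum to zero over a period.
  · refine ⟨3, by simp, fun z hper hz => ?_⟩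
    have a := hz 0
    norm_num at a ⊢; linarith
  · refine ⟨4, by simp, fun z hper hz => ?_⟩
    have a := hz 0
    have b := hz 1
    norm_num at a b ⊢; linarith
  · refine ⟨6, by simp, fun z hper hz => ?_⟩
    have a := hz 0
    have b := hz 1
    have c := hz 2
    have d := hz 3
    norm_num at a b c d ⊢; linarith
  · refine ⟨1, by simp, fun z hper hz => ?_⟩
    -- Double characteristic root 1: the differences form an arithmetic progression. Periodicity
    -- kills first its step and then the differences themselves.
    have key : ∀ n : ℕ, z (n + 1) - z n = (z 1 - z 0) + n * (z 2 - 2 * z 1 + z 0) ∧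
        z (n + 2) - z (n + 1) = (z 1 - z 0) + (n + 1) * (z 2 - 2 * z 1 + z 0) := by
      intro n
      induction n with
      | zero => norm_num; ring
      | succ n ih =>
        have a := hz n
        push_cast
        ring_nf at a ih ⊢
        constructor <;> linarith [ih.1, ih.2]
    have c0 : z 2 - 2 * z 1 + z 0 = 0 := by
      have e := (key m).1
      rw [add_comm (m : ℤ) 1, hper, show z m = z 0 by simpa using hper 0] at e
      exact (mul_eq_zero.1 (show (m : ℤ) * _ = 0 by linarith)).resolve_left hm'
    have lin : ∀ n : ℕ, z n = z 0 + n * (z 1 - z 0) := by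
      intro n
      induction n with
      | zero => simp
      | succ n ih =>
        have := (key n).1
        rw [c0] at this
        push_cast; linarith
    have e := lin m
    rw [show z m = z 0 by simpa using hper 0] at e
    have := (mul_eq_zero.1 (show (m : ℤ) * (z 1 - z 0) = 0 by linarith)).resolve_left hm'
    push_cast; linarith

/-! ### Paired lattice polygons. -/

namespace IsPairedPolygon

variable {m : ℕ} {θ : ℤ → ℝ} {z : ℤ → ℤ × ℤ}

/-- The oblique reflection in direction `θ i` reverses determinants of the second differences. -/
theorem planeDet_reflect (h : IsPairedPolygon m θ z) (i a b : ℤ) :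
    planeDet (z (a + 2) - z a) (z (b + 2) - z b) =
      -planeDet (z (2 * i - 3 - a + 2) - z (2 * i - 3 - a))
        (z (2 * i - 3 - b + 2) - z (2 * i - 3 - b)) := by
  have hm := h.four_lt
  have s0 := h.sin_pos (i := i - 1) (k := i + 1) (by omega) (by omega)
  have s1 := h.sin_pos (i := i) (k := i + 1) (by omega) (by omega)
  have s2 := h.sin_pos (i := i - 1) (k := i) (by omega) (by omega)
  -- The four vertices involved are joined by chords in directions `i - 1`, `i`, `i + 1`. So the map
  -- from a step to its mirror image is triangular in the coordinates at `θ i` and `θ (i + 1)`, with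
  -- diagonal `-1, 1` and coefficients independent of `a`. Its determinant is -1.
  have key : ∀ a : ℤ, sideForm (θ i) (z (a + 2) - z a) =
        -sideForm (θ i) (z (2 * i - 3 - a + 2) - z (2 * i - 3 - a)) ∧
      Real.sin (θ i - θ (i - 1)) * (sideForm (θ (i + 1)) (z (a + 2) - z a)
        - sideForm (θ (i + 1)) (z (2 * i - 3 - a + 2) - z (2 * i - 3 - a))) =
      Real.sin (θ (i + 1) - θ (i - 1)) * sideForm (θ i) (z (a + 2) - z a) := by
    intro a
    have p1 := h.paired i (a + 2) (2 * i - 3 - a) (by ring)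
    have p2 := h.paired i a (2 * i - 3 - a + 2) (by ring)
    have p3 := h.paired (i + 1) (a + 2) (2 * i - 3 - a + 2) (by ring)
    have p4 := h.paired (i - 1) (2 * i - 3 - a) a (by ring)
    have e := sideForm_three_term (θ (i - 1)) (θ i) (θ (i + 1)) (z (2 * i - 3 - a) - z a)
    rw [show Real.sin (θ (i - 1) - θ (i + 1)) = -Real.sin (θ (i + 1) - θ (i - 1)) by
      rw [← Real.sin_neg, neg_sub]] at e
    simp only [sideForm_sub] at e ⊢
    constructor
    · linarith
    · rw [p4] at e
      rw [p3, p1]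
      linear_combination e
  obtain ⟨a1, a2⟩ := key a
  obtain ⟨b1, b2⟩ := key b
  have d1 := sideForm_mul_sub_mul (θ i) (θ (i + 1)) (z (a + 2) - z a) (z (b + 2) - z b)
  have d2 := sideForm_mul_sub_mul (θ i) (θ (i + 1)) (z (2 * i - 3 - a + 2) - z (2 * i - 3 - a))
    (z (2 * i - 3 - b + 2) - z (2 * i - 3 - b))
  have flip : ∀ p q, planeDet q p = -planeDet p q := fun p q => by simp only [planeDet]; ring
  rw [flip] at d1 d2
  generalize z (a + 2) - z a = A at *
  generalize z (b + 2) - z b = B at *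
  generalize z (2 * i - 3 - a + 2) - z (2 * i - 3 - a) = A' at *
  generalize z (2 * i - 3 - b + 2) - z (2 * i - 3 - b) = B' at *
  have hs := mul_pos s1 s2
  have : (planeDet A B : ℝ) = -planeDet A' B' := by
    apply mul_left_cancel₀ hs.ne'
    push_cast at d1 d2
    have c1 : sideForm (θ i) A' = -sideForm (θ i) A := by linarith
    have c2 : sideForm (θ i) B' = -sideForm (θ i) B := by linarith
    rw [c1, c2] at d2
    linear_combination (-Real.sin (θ i - θ (i - 1))) * d1 - Real.sin (θ i - θ (i - 1)) * d2
      + sideForm (θ i) A * b2 - sideForm (θ i) B * a2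
  exact_mod_cast this

/-- Two reflections in consecutive directions compose to a rotation of the indices by 2, and their
signs cancel. -/
theorem planeDet_shift (h : IsPairedPolygon m θ z) (a b : ℤ) :
    planeDet (z (a + 2) - z a) (z (b + 2) - z b) =
      planeDet (z (a + 2 + 2) - z (a + 2)) (z (b + 2 + 2) - z (b + 2)) := by
  rw [h.planeDet_reflect 0 a b, h.planeDet_reflect 1 (a + 2) (b + 2)]
  ring_nf

/-- Expanded over the edges 1 to 4, whose angles lie within a half turn because `4 < m`, the
determinant is a sum of positive terms. -/
theorem planeDet_pos (h : IsPairedPolygon m θ z) :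
    0 < planeDet (z 2 - z 0) (z 4 - z 2) := by
  have hm := h.four_lt
  obtain ⟨t1, p1, x1, y1⟩ := h.edge 1
  obtain ⟨t2, p2, x2, y2⟩ := h.edge 2
  obtain ⟨t3, p3, x3, y3⟩ := h.edge 3
  obtain ⟨t4, p4, x4, y4⟩ := h.edge 4
  norm_num at x1 x2 x3 x4 y1 y2 y3 y4
  have q1 := mul_pos (mul_pos p1 p3) (h.sin_pos (i := 1) (k := 3) (by omega) (by omega))
  have q2 := mul_pos (mul_pos p1 p4) (h.sin_pos (i := 1) (k := 4) (by omega) (by omega))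
  have q3 := mul_pos (mul_pos p2 p3) (h.sin_pos (i := 2) (k := 3) (by omega) (by omega))
  have q4 := mul_pos (mul_pos p2 p4) (h.sin_pos (i := 2) (k := 4) (by omega) (by omega))
  have e : (planeDet (z 2 - z 0) (z 4 - z 2) : ℝ) =
      t1 * t3 * Real.sin (θ 3 - θ 1) + t1 * t4 * Real.sin (θ 4 - θ 1)
      + t2 * t3 * Real.sin (θ 3 - θ 2) + t2 * t4 * Real.sin (θ 4 - θ 2) := by
    have X1 : ((z 2).1 : ℝ) - (z 0).1 = t1 * Real.cos (θ 1) + t2 * Real.cos (θ 2) := by linarith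
    have Y1 : ((z 2).2 : ℝ) - (z 0).2 = t1 * Real.sin (θ 1) + t2 * Real.sin (θ 2) := by linarith
    have X2 : ((z 4).1 : ℝ) - (z 2).1 = t3 * Real.cos (θ 3) + t4 * Real.cos (θ 4) := by linarith
    have Y2 : ((z 4).2 : ℝ) - (z 2).2 = t3 * Real.sin (θ 3) + t4 * Real.sin (θ 4) := by linarith
    simp only [planeDet, Prod.fst_sub, Prod.snd_sub]
    push_cast
    rw [X1, X2, Y1, Y2]
    simp only [Real.sin_sub]; ring
  have : (0 : ℝ) < planeDet (z 2 - z 0) (z 4 - z 2) := by rw [e]; linarith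
  exact_mod_cast this

/-- The form at `θ j` increases strictly from `z j` to `z (j + m - 1)`, and `z (j + m)` is level
with the latter. -/
theorem ne_of_lt_of_le (h : IsPairedPolygon m θ z) {j k : ℤ} (h1 : j < k) (h2 : k ≤ j + m) :
    z j ≠ z k := by
  have hm := h.four_lt
  have hstep : ∀ k, j < k → k < j + m → sideForm (θ j) (z (k - 1)) < sideForm (θ j) (z k) := by
    intro k h1 h2
    obtain ⟨t, ht, e1, e2⟩ := h.edge k
    have := sideForm_sub_of_edge (i := θ j) e1 e2
    have s := mul_pos ht (h.sin_pos h1 h2)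
    linarith
  have hmono : ∀ d : ℕ, (d : ℤ) + 1 < m →
      sideForm (θ j) (z j) < sideForm (θ j) (z (j + d + 1)) := by
    intro d
    induction d with
    | zero =>
      intro hd
      have := hstep (j + 1) (by omega) (by omega)
      simpa using this
    | succ d ih =>
      intro hd
      have := hstep (j + d + 1 + 1) (by omega) (by omega)
      rw [show j + (d : ℤ) + 1 + 1 - 1 = j + d + 1 by ring] at this
      push_cast at hd ⊢
      exact (ih (by omega)).trans (by rwa [← add_assoc])
  rcases lt_or_eq_of_le h2 with h2 | h2
  · obtain ⟨d, rfl⟩ : ∃ d : ℕ, k = j + d + 1 := ⟨(k - j - 1).toNat, by omega⟩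
    intro e
    have := hmono d (by omega)
    rw [← e] at this
    exact lt_irrefl _ this
  · intro e
    have h3 := hmono (m - 2) (by omega)
    have e2 := h.paired (j + m) k (j + m - 1) (by omega)
    simp only [h.sideForm_add, neg_inj] at e2
    rw [show j + ((m - 2 : ℕ) : ℤ) + 1 = j + m - 1 by omega, ← e2, ← e] at h3
    exact lt_irrefl _ h3

theorem ne_of_lt (h : IsPairedPolygon m θ z) {k : ℤ} (h1 : 0 < k) (h2 : k < 2 * m) :
    z 0 ≠ z k := by
  by_cases hk : k ≤ m
  · exact h.ne_of_lt_of_le h1 (by omega)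
  · have := h.ne_of_lt_of_le (j := k) (k := 0 + 2 * m) (by omega) (by omega)
    rw [h.periodic] at this
    exact this.symm

theorem eq_six (h : IsPairedPolygon m θ z) : m = 6 := by
  have hm := h.four_lt
  set Z : ℤ → ℤ × ℤ := fun k => z (2 * k) with hZ
  set W : ℤ → ℤ × ℤ := fun k => Z (k + 1) - Z k with hW
  have hWz : ∀ k, W k = z (2 * k + 2) - z (2 * k) := fun k => by
    simp only [hW, hZ]; rw [show 2 * (k + 1) = 2 * k + 2 by ring]
  have hper : ∀ k, Z (k + m) = Z k := fun k => by
    simp only [hZ]; rw [mul_add]; exact h.periodic _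
  have hshift : ∀ a b, planeDet (W a) (W b) = planeDet (W (a + 1)) (W (b + 1)) := by
    intro a b
    simp only [hWz]
    rw [h.planeDet_shift]
    ring_nf
  have hinv : ∀ d k, planeDet (W k) (W (k + d)) = planeDet (W 0) (W d) := by
    intro d k
    induction k using Int.induction_on with
    | zero => simp
    | succ k ih => rw [← ih, hshift k]; ring_nf
    | pred k ih => rw [← ih, hshift (-(k : ℤ) - 1)]; ring_nf
  obtain ⟨D, hD⟩ : ∃ D, D = planeDet (W 0) (W 1) := ⟨_, rfl⟩
  obtain ⟨E, hE⟩ : ∃ E, E = planeDet (W 0) (W 2) := ⟨_, rfl⟩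
  have hDpos : 0 < D := by rw [hD]; exact h.planeDet_pos
  -- The linear relation between three plane vectors, with determinants as coefficients.
  have hrec : ∀ k, D * ((W (k + 2)).1 + (W k).1) = E * (W (k + 1)).1 ∧
      D * ((W (k + 2)).2 + (W k).2) = E * (W (k + 1)).2 := by
    intro k
    have h1 := hinv 1 k
    have h2 := hinv 1 (k + 1)
    have h3 := hinv 2 k
    rw [show k + 1 + 1 = k + 2 by ring, ← hD] at h2
    rw [← hD] at h1
    rw [← hE] at h3
    simp only [planeDet] at h1 h2 h3
    constructor
    · linear_combination (-(W (k + 2)).1) * h1 - (W k).1 * h2 + (W (k + 1)).1 * h3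
    · linear_combination (-(W (k + 2)).2) * h1 - (W k).2 * h2 + (W (k + 1)).2 * h3
  have hWper : ∀ k, W (k + m) = W k := fun k => by
    simp only [hW]; rw [show k + m + 1 = k + 1 + m by ring, hper, hper]
  obtain ⟨τ, rfl, hτ⟩ : ∃ τ, E = D * τ ∧ |τ| ≤ 2 := by
    have hW0 : (W 0).1 ≠ 0 ∨ (W 0).2 ≠ 0 := by
      by_contra! hcon
      rw [planeDet, hcon.1, hcon.2] at hD
      omega
    rcases hW0 with h0 | h0
    · obtain ⟨τ, hτ⟩ := dvd_of_recurrence (x := fun k => (W k).1) hDpos.ne' (fun k => (hrec k).1) h0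
      refine ⟨τ, hτ, abs_le_two_of_recurrence (x := fun k => (W k).1) (m := m) (by omega)
        (fun k => mul_left_cancel₀ hDpos.ne' ?_) (fun k => by simp only [hWper]) h0⟩
      rw [(hrec k).1, hτ]; ring
    · obtain ⟨τ, hτ⟩ := dvd_of_recurrence (x := fun k => (W k).2) hDpos.ne' (fun k => (hrec k).2) h0
      refine ⟨τ, hτ, abs_le_two_of_recurrence (x := fun k => (W k).2) (m := m) (by omega)
        (fun k => mul_left_cancel₀ hDpos.ne' ?_) (fun k => by simp only [hWper]) h0⟩
      rw [(hrec k).2, hτ]; ring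
  obtain ⟨r, hr, hperiod⟩ := exists_period_of_recurrence hτ (m := m) (by omega)
  have hrec' : ∀ k, (W (k + 2)).1 + (W k).1 = τ * (W (k + 1)).1 ∧
      (W (k + 2)).2 + (W k).2 = τ * (W (k + 1)).2 := fun k =>
    ⟨mul_left_cancel₀ hDpos.ne' (by rw [(hrec k).1]; ring),
      mul_left_cancel₀ hDpos.ne' (by rw [(hrec k).2]; ring)⟩
  have hW' : ∀ k, W (k + 1) = Z (k + 2) - Z (k + 1) ∧ W (k + 2) = Z (k + 3) - Z (k + 2) :=
    fun k => ⟨by simp only [hW]; ring_nf, by simp only [hW]; ring_nf⟩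
  have e : Z r = Z 0 := by
    refine Prod.ext (hperiod (fun k => (Z k).1) (fun k => by simp only [hper]) fun k => ?_)
      (hperiod (fun k => (Z k).2) (fun k => by simp only [hper]) fun k => ?_)
    · have := (hrec' k).1
      rw [(hW' k).1, (hW' k).2] at this
      exact this
    · have := (hrec' k).2
      rw [(hW' k).1, (hW' k).2] at this
      exact this
  have e' : z 0 = z (2 * (r : ℤ)) := e.symm
  by_contra hm6
  have hne : ∀ k : ℤ, 0 < k → k < 2 * m → z 0 ≠ z k := fun k => h.ne_of_lt
  simp only [Finset.mem_insert, Finset.mem_singleton] at hr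
  by_cases hbig : r < m
  · exact hne _ (by omega) (by omega) e'
  -- Only `m = 5`, `r = 6` remains. The polygon then has period 10, so `z 0 = z 12 = z 2`.
  · have : r = 6 := by omega
    subst this
    have h5 : (m : ℤ) = 5 := by omega
    have := h.periodic 2
    rw [h5] at this
    norm_num at this e'
    exact hne 2 (by omega) (by omega) (by rw [e', this])

end IsPairedPolygon

/-! ### Small switchings are tight. -/

theorem IsAngleFamily.isTightSwitching {m : ℕ} {θ : ℤ → ℝ} {F F' : Finset (ℤ × ℤ)}
    (h : IsAngleFamily m θ) (hm : 4 < m) (hne : F.Nonempty) (hdisj : Disjoint F F')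
    (hcard : F.card = F'.card) (hle : F.card ≤ m)
    (hcount : ∀ i c, (F.filter fun p => sideForm (θ i) p = c).card =
      (F'.filter fun p => sideForm (θ i) p = c).card) :
    IsTightSwitching m θ F F' := by
  have hone : ∀ i : ℤ, ∀ p ∈ F, 1 ≤ (F.filter fun q => sideForm (θ i) q = sideForm (θ i) p).card :=
    fun i p hp => Finset.card_pos.2 ⟨p, by simp [hp]⟩
  have hpair : ∀ p ∈ F, ∀ q ∈ F',
      ((Finset.range m).filter fun i : ℕ => sideForm (θ i) q = sideForm (θ i) p).card ≤ 1 := by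
    intro p hp q hq
    refine Finset.card_le_one.2 fun i hi j hj => ?_
    simp only [Finset.mem_filter, Finset.mem_range] at hi hj
    by_contra hij
    have hpq : p ≠ q := fun e => Finset.disjoint_left.1 hdisj hp (e ▸ hq)
    rcases lt_or_gt_of_ne hij with hlt | hlt
    · exact hpq (eq_of_sideForm_eq (h.sin_pos (i := i) (k := j) (by omega) (by omega)).ne'
        hi.2.symm hj.2.symm)
    · exact hpq (eq_of_sideForm_eq (h.sin_pos (i := j) (k := i) (by omega) (by omega)).ne'
        hj.2.symm hi.2.symm)
  have hdouble : ∑ i ∈ Finset.range m, ∑ p ∈ F,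
        (F.filter fun q => sideForm (θ i) q = sideForm (θ i) p).card =
      ∑ p ∈ F, ∑ q ∈ F',
        ((Finset.range m).filter fun i : ℕ => sideForm (θ i) q = sideForm (θ i) p).card := by
    simp only [hcount]
    rw [Finset.sum_comm]
    refine Finset.sum_congr rfl fun p _ => ?_
    simp only [Finset.card_filter]
    exact Finset.sum_comm
  have hlow : m * F.card ≤ ∑ i ∈ Finset.range m, ∑ p ∈ F,
      (F.filter fun q => sideForm (θ i) q = sideForm (θ i) p).card := by
    calc m * F.card = ∑ i ∈ Finset.range m, ∑ p ∈ F, 1 := by simp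
      _ ≤ _ := Finset.sum_le_sum fun i _ => Finset.sum_le_sum fun p hp => hone i p hp
  have hhigh : ∑ p ∈ F, ∑ q ∈ F',
        ((Finset.range m).filter fun i : ℕ => sideForm (θ i) q = sideForm (θ i) p).card ≤
      F.card * F.card := by
    calc _ ≤ ∑ p ∈ F, ∑ q ∈ F', 1 :=
          Finset.sum_le_sum fun p hp => Finset.sum_le_sum fun q hq => hpair p hp q hq
      _ = F.card * F.card := by simp [hcard]
  have hFm : F.card = m := by
    have := Finset.card_pos.2 hne
    exact le_antisymm hle (Nat.le_of_mul_le_mul_right (hlow.trans (hdouble.trans_le hhigh)) this)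
  have hlevel_nat : ∀ i < m, ∀ p ∈ F,
      (F.filter fun q => sideForm (θ (i : ℕ)) q = sideForm (θ i) p).card = 1 := by
    have e : ∑ i ∈ Finset.range m, ∑ p ∈ F, 1 = ∑ i ∈ Finset.range m, ∑ p ∈ F,
        (F.filter fun q => sideForm (θ i) q = sideForm (θ i) p).card := by
      refine le_antisymm (by simpa using hlow) ?_
      rw [hdouble]; simpa [hFm] using hhigh
    rw [Finset.sum_eq_sum_iff_of_le
      (fun (i : ℕ) _ => Finset.sum_le_sum fun p hp => hone i p hp)] at e
    intro i hi p hp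
    have e2 := e i (Finset.mem_range.2 hi)
    rw [Finset.sum_eq_sum_iff_of_le (fun p hp => hone i p hp)] at e2
    exact (e2 p hp).symm
  have hlevel : ∀ i : ℤ, ∀ p ∈ F,
      (F.filter fun q => sideForm (θ i) q = sideForm (θ i) p).card = 1 := by
    intro i p hp
    have r0 := Int.emod_nonneg (i - 0) (b := (m : ℤ)) (by omega)
    have r1 := Int.emod_lt_of_pos (i - 0) (b := (m : ℤ)) (by omega)
    have := hlevel_nat (((i - 0) % m).toNat) (by omega) p hp
    rw [Int.toNat_of_nonneg r0] at this
    rw [← this]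
    congr 1
    refine Finset.filter_congr fun q _ => ?_
    rw [← h.tie_emod i 0, zero_add]
  have hcover : ∀ p ∈ F, ∀ q ∈ F', ∃ i, sideForm (θ i) p = sideForm (θ i) q := by
    have e : ∑ p ∈ F, ∑ q ∈ F', ((Finset.range m).filter fun i : ℕ =>
        sideForm (θ i) q = sideForm (θ i) p).card = ∑ p ∈ F, ∑ q ∈ F', 1 := by
      refine le_antisymm (by simpa [← hcard] using hhigh) ?_
      rw [← hdouble]; simpa [← hcard, hFm] using hlow
    rw [Finset.sum_eq_sum_iff_of_le
      (fun p hp => Finset.sum_le_sum fun q hq => hpair p hp q hq)] at e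
    intro p hp q hq
    have e2 := e p hp
    rw [Finset.sum_eq_sum_iff_of_le (fun q hq => hpair p hp q hq)] at e2
    obtain ⟨i, hi⟩ := Finset.card_pos.1 ((e2 q hq).symm ▸ Nat.one_pos)
    exact ⟨i, (Finset.mem_filter.1 hi).2.symm⟩
  have hright : ∀ i, ∀ p ∈ F, ∃ q ∈ F', sideForm (θ i) q = sideForm (θ i) p := by
    intro i p hp
    have := hlevel i p hp
    rw [hcount] at this
    obtain ⟨q, hq⟩ := Finset.card_pos.1 (this.symm ▸ Nat.one_pos)
    exact ⟨q, (Finset.mem_filter.1 hq).1, (Finset.mem_filter.1 hq).2⟩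
  have hleft : ∀ i, ∀ q ∈ F', ∃ p ∈ F, sideForm (θ i) p = sideForm (θ i) q := by
    intro i q hq
    have : 0 < (F.filter fun p => sideForm (θ i) p = sideForm (θ i) q).card := by
      rw [hcount]; exact Finset.card_pos.2 ⟨q, by simp [hq]⟩
    obtain ⟨p, hp⟩ := Finset.card_pos.1 this
    exact ⟨p, (Finset.mem_filter.1 hp).1, (Finset.mem_filter.1 hp).2⟩
  refine ⟨h, hm, hdisj, hFm, hcard ▸ hFm, hright, hleft, ?_, ?_, hcover⟩
  · intro i p hp p' hp' e
    exact Finset.card_le_one.1 (hlevel i p hp).le p (by simpa using hp) p'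
      (Finset.mem_filter.2 ⟨hp', e.symm⟩)
  · intro i q hq q' hq' e
    obtain ⟨p, hp, epq⟩ := hleft i q hq
    have := hlevel i p hp
    rw [hcount] at this
    exact Finset.card_le_one.1 this.le q (Finset.mem_filter.2 ⟨hq, epq.symm⟩) q'
      (Finset.mem_filter.2 ⟨hq', e.symm.trans epq.symm⟩)

/-! ### From real directions and X-rays to angles and level counts. -/

theorem exists_polar_angle {x y : ℝ} (h : x ≠ 0 ∨ y ≠ 0) :
    ∃ θ ∈ Set.Ico 0 Real.pi, ∃ r : ℝ, r ≠ 0 ∧ x = r * Real.cos θ ∧ y = r * Real.sin θ := by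
  set w : ℂ := ⟨x, y⟩ with hw
  have hw0 : ‖w‖ ≠ 0 := by
    rw [norm_ne_zero_iff]
    intro e
    have e1 := congrArg Complex.re e
    have e2 := congrArg Complex.im e
    simp [hw] at e1 e2
    tauto
  have hx : x = ‖w‖ * Real.cos w.arg := (Complex.norm_mul_cos_arg w).symm
  have hy : y = ‖w‖ * Real.sin w.arg := (Complex.norm_mul_sin_arg w).symm
  have h1 := Complex.neg_pi_lt_arg w
  have h2 := Complex.arg_le_pi w
  rcases lt_or_ge w.arg 0 with hneg | hnn
  · exact ⟨w.arg + Real.pi, ⟨by linarith, by linarith⟩, -‖w‖, neg_ne_zero.2 hw0,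
      by rw [Real.cos_add_pi]; linarith, by rw [Real.sin_add_pi]; linarith⟩
  · rcases eq_or_lt_of_le h2 with hpi | hlt
    · rw [hpi] at hx hy
      exact ⟨0, ⟨le_rfl, Real.pi_pos⟩, -‖w‖, neg_ne_zero.2 hw0, by simpa using hx, by simpa using hy⟩
    · exact ⟨w.arg, ⟨hnn, hlt⟩, ‖w‖, hw0, hx, hy⟩

/-- Sort the angles and repeat the list, adding `π` after every `m` terms. -/
theorem exists_isAngleFamily {m : ℕ} (hm : 0 < m) {φ : Fin m → ℝ} (hinj : Function.Injective φ)
    (hφ : ∀ j, φ j ∈ Set.Ico 0 Real.pi) :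
    ∃ θ : ℤ → ℝ, IsAngleFamily m θ ∧ ∀ i, ∃ j, ∃ n : ℤ, θ i = φ j + n * Real.pi := by
  have hcard : (Finset.univ.image φ).card = m := by
    rw [Finset.card_image_of_injective _ hinj, Finset.card_univ, Fintype.card_fin]
  set T := (Finset.univ.image φ).orderEmbOfFin hcard with hT
  have hTmem : ∀ k, ∃ j, φ j = T k := fun k => by
    have := Finset.orderEmbOfFin_mem (Finset.univ.image φ) hcard k
    obtain ⟨j, -, hj⟩ := Finset.mem_image.1 this
    exact ⟨j, hj⟩
  have hTI : ∀ k, T k ∈ Set.Ico 0 Real.pi := fun k => by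
    obtain ⟨j, hj⟩ := hTmem k
    rw [← hj]; exact hφ j
  have hr0 : ∀ i : ℤ, 0 ≤ i % m := fun i => Int.emod_nonneg _ (by omega)
  have hr1 : ∀ i : ℤ, i % m < m := fun i => Int.emod_lt_of_pos _ (by omega)
  have hr : ∀ i : ℤ, (i % m).toNat < m := fun i => by have := hr0 i; have := hr1 i; omega
  refine ⟨fun i => T ⟨(i % m).toNat, hr i⟩ + ((i / m : ℤ) : ℝ) * Real.pi, ⟨?_, ?_⟩, ?_⟩
  · intro a b hab
    have da := Int.emod_add_mul_ediv a m
    have db := Int.emod_add_mul_ediv b m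
    have hdiv : a / m ≤ b / m := Int.ediv_le_ediv (by omega) hab.le
    rcases eq_or_lt_of_le hdiv with e | hlt
    · have : T ⟨(a % m).toNat, hr a⟩ < T ⟨(b % m).toNat, hr b⟩ := by
        refine T.strictMono ?_
        have := hr0 a
        rw [e] at da
        exact Fin.mk_lt_mk.2 (by omega)
      simp only [e]; linarith
    · have h1 := (hTI ⟨(a % m).toNat, hr a⟩).2
      have h2 := (hTI ⟨(b % m).toNat, hr b⟩).1
      have h3 : ((a / m : ℤ) : ℝ) + 1 ≤ (b / m : ℤ) := by exact_mod_cast hlt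
      have := mul_le_mul_of_nonneg_right h3 Real.pi_pos.le
      simp only; linarith
  · intro i
    have e1 : (i + m) % (m : ℤ) = i % m := by simp
    have e2 : (i + m) / (m : ℤ) = i / m + 1 := Int.add_ediv_of_dvd_right (dvd_refl _) |>.trans
      (by rw [Int.ediv_self (by omega)])
    simp only [e1, e2]
    push_cast; ring
  · intro i
    obtain ⟨j, hj⟩ := hTmem ⟨(i % m).toNat, hr i⟩
    exact ⟨j, i / m, by simp only [hj]⟩

/-- The inclusion of the integer lattice in the plane. -/
def latticePoint (p : ℤ × ℤ) : Fin 2 → ℝ := ![(p.1 : ℝ), p.2]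

theorem latticePoint_injective : Function.Injective latticePoint := by
  intro p q h
  have h0 := congrFun h 0
  have h1 := congrFun h 1
  simp only [latticePoint, Matrix.cons_val_zero, Matrix.cons_val_one] at h0 h1
  exact Prod.ext (by exact_mod_cast h0) (by exact_mod_cast h1)

theorem PointsIn.exists_image {F : Finset (Fin 2 → ℝ)} (hF : PointsIn intSet F) :
    ∃ G : Finset (ℤ × ℤ), G.image latticePoint = F := by
  classical
  refine ⟨F.preimage latticePoint latticePoint_injective.injOn, ?_⟩
  rw [Finset.image_preimage, Finset.filter_true_of_mem]
  intro p hp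
  obtain ⟨a, ha⟩ := hF p hp 0
  obtain ⟨b, hb⟩ := hF p hp 1
  refine ⟨(a, b), ?_⟩
  ext i
  fin_cases i
  · simpa [latticePoint] using ha
  · simpa [latticePoint] using hb

/-- The line at level `c` is named by the foot of the perpendicular from the origin. -/
theorem xray_image_latticePoint (G : Finset (ℤ × ℤ)) {s : Fin 2 → ℝ} {φ r : ℝ} (hr : r ≠ 0)
    (h0 : s 0 = r * Real.cos φ) (h1 : s 1 = r * Real.sin φ) (c : ℝ) :
    xray (G.image latticePoint) s ![-c * Real.sin φ, c * Real.cos φ] =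
      (G.filter fun p => sideForm φ p = c).card := by
  rw [← Finset.card_image_of_injective _ latticePoint_injective, ← Set.ncard_coe_finset, xray]
  congr 1
  ext p
  simp only [Finset.mem_image, Set.mem_ofPred_eq, Finset.coe_image, Finset.coe_filter,
    Set.mem_image]
  have hsc := Real.sin_sq_add_cos_sq φ
  constructor
  · rintro ⟨⟨q, hq, rfl⟩, t, ht⟩
    refine ⟨q, ⟨hq, ?_⟩, rfl⟩
    have e0 := congrFun ht 0
    have e1 := congrFun ht 1
    simp [latticePoint, h0, h1] at e0 e1
    rw [sideForm, e0, e1]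
    linear_combination c * hsc
  · rintro ⟨q, ⟨hq, hc⟩, rfl⟩
    refine ⟨⟨q, hq, rfl⟩, (Real.cos φ * q.1 + Real.sin φ * q.2) / r, ?_⟩
    rw [sideForm] at hc
    ext i
    fin_cases i
    · simp [latticePoint, h0]
      field_simp
      rw [← hc]
      linear_combination (-(q.1 : ℝ)) * hsc
    · simp [latticePoint, h1]
      field_simp
      rw [← hc]
      linear_combination (-(q.2 : ℝ)) * hsc

/-- Adding an integer multiple of `π` to the angle does not change the lines. -/
theorem card_filter_sideForm_add_int_mul_pi {G G' : Finset (ℤ × ℤ)} {φ : ℝ}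
    (h : ∀ c, (G.filter fun p => sideForm φ p = c).card =
      (G'.filter fun p => sideForm φ p = c).card) (n : ℤ) (c : ℝ) :
    (G.filter fun p => sideForm (φ + n * Real.pi) p = c).card =
      (G'.filter fun p => sideForm (φ + n * Real.pi) p = c).card := by
  have key : ∀ p, sideForm (φ + n * Real.pi) p = (-1) ^ n * sideForm φ p := fun p => by
    simp only [sideForm, Real.cos_add_int_mul_pi, Real.sin_add_int_mul_pi]; ring
  have hu : ((-1 : ℝ) ^ n) * (-1) ^ n = 1 := by
    rw [← zpow_add₀ (by norm_num), (Even.add_self n).neg_one_zpow]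
  have key2 : ∀ p, sideForm (φ + n * Real.pi) p = c ↔ sideForm φ p = (-1) ^ n * c := fun p => by
    rw [key]
    constructor
    · intro e; rw [← e, ← mul_assoc, hu, one_mul]
    · intro e; rw [e, ← mul_assoc, hu, one_mul]
  simp only [key2, h]

theorem not_forall_xray_eq {m : ℕ} (hm : m = 5 ∨ 6 < m) {n : ℕ} (hn : n ≤ m)
    {s : Fin m → Fin 2 → ℝ} (hs : PairwiseIndependent s) {F F' : Finset (Fin 2 → ℝ)}
    (hF : PointsIn intSet F) (hF' : PointsIn intSet F') (hFn : F.card = n) (hFn' : F'.card = n)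
    (hne : F ≠ F') : ¬ ∀ i, xray F (s i) = xray F' (s i) := by
  classical
  intro hx
  have hm4 : 4 < m := by omega
  have hs0 : ∀ j, s j 0 ≠ 0 ∨ s j 1 ≠ 0 := by
    intro j
    obtain ⟨k, hk⟩ : ∃ k : Fin m, j ≠ k := by
      have : Nontrivial (Fin m) := Fin.nontrivial_iff_two_le.2 (by omega)
      exact (exists_ne j).imp fun _ => Ne.symm
    have := (hs j k hk).ne_zero 0
    by_contra! hcon
    refine this ?_
    ext i
    fin_cases i
    · simpa using hcon.1
    · simpa using hcon.2
  choose φ hφ r hr hc hsn using fun j => exists_polar_angle (hs0 j)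
  have hinj : Function.Injective φ := by
    intro j k e
    by_contra hjk
    have := LinearIndependent.pair_iff.1 (hs j k hjk) (r k) (-r j) (by
      ext i
      fin_cases i
      · simp [hc j, hc k, e]; ring
      · simp [hsn j, hsn k, e]; ring)
    exact hr k this.1
  obtain ⟨θ, hθ, hθφ⟩ := exists_isAngleFamily (by omega) hinj hφ
  obtain ⟨G, rfl⟩ := hF.exists_image
  obtain ⟨G', rfl⟩ := hF'.exists_image
  rw [Finset.card_image_of_injective _ latticePoint_injective] at hFn hFn'
  have hcount : ∀ i c, (G.filter fun p => sideForm (θ i) p = c).card =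
      (G'.filter fun p => sideForm (θ i) p = c).card := by
    intro i c
    obtain ⟨j, l, e⟩ := hθφ i
    rw [e]
    refine card_filter_sideForm_add_int_mul_pi (fun c => ?_) l c
    rw [← xray_image_latticePoint G (hr j) (hc j) (hsn j),
      ← xray_image_latticePoint G' (hr j) (hc j) (hsn j), hx]
  -- Common points count equally on both sides, so they can be removed.
  have hsd : ∀ P : ℤ × ℤ → Prop, (G.filter P).card = (G'.filter P).card →
      ((G \ G').filter P).card = ((G' \ G).filter P).card := by
    intro P hP
    have e : ∀ A B : Finset (ℤ × ℤ), (A \ B).filter P = A.filter P \ B.filter P := by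
      intro A B; ext p; simp only [Finset.mem_filter, Finset.mem_sdiff]; tauto
    rw [e, e]
    exact Finset.card_sdiff_comm hP
  have hGG : G ≠ G' := fun e => hne (by rw [e])
  have hnonempty : (G \ G').Nonempty := by
    rw [Finset.sdiff_nonempty]
    exact fun hsub => hGG (Finset.eq_of_subset_of_card_le hsub (by omega))
  obtain ⟨z, hz⟩ := (hθ.isTightSwitching hm4 hnonempty disjoint_sdiff_sdiff
    (Finset.card_sdiff_comm (hFn.trans hFn'.symm))
    ((Finset.card_le_card Finset.sdiff_subset).trans (hFn.trans_le hn))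
    (fun i c => hsd _ (hcount i c))).exists_isPairedPolygon
  have := hz.eq_six
  omega

/-! ### Existence of switchings: projected cubes. -/

/-- The sum of the vectors `(1, 2 ^ i)` over `i ∈ S`. -/
def subsetSumPoint (S : Finset ℕ) : Fin 2 → ℝ := ![(S.card : ℝ), ((∑ i ∈ S, 2 ^ i : ℕ) : ℝ)]

theorem subsetSumPoint_injective : Function.Injective subsetSumPoint := by
  intro S T h
  have h1 := congrFun h 1
  simp only [subsetSumPoint, Matrix.cons_val_one, Matrix.cons_val_fin_one] at h1
  exact Finset.geomSum_injective le_rfl (by exact_mod_cast h1)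

theorem subsetSumPoint_insert {S : Finset ℕ} {i : ℕ} (hi : i ∉ S) :
    subsetSumPoint (insert i S) = subsetSumPoint S + ![1, (2 : ℝ) ^ i] := by
  ext k
  fin_cases k
  · simp [subsetSumPoint, Finset.card_insert_of_notMem hi]
  · simp [subsetSumPoint, Finset.sum_insert hi, add_comm]

theorem exists_subsetSumPoint_symmDiff (S : Finset ℕ) (i : ℕ) :
    ∃ t : ℝ, subsetSumPoint (symmDiff S {i}) = subsetSumPoint S + t • ![1, (2 : ℝ) ^ i] := by
  by_cases hi : i ∈ S
  · refine ⟨-1, ?_⟩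
    have e : symmDiff S {i} = S.erase i := by
      ext j; by_cases hj : j = i <;> simp [Finset.mem_symmDiff, hj, hi]
    have := subsetSumPoint_insert (Finset.notMem_erase i S)
    rw [Finset.insert_erase hi] at this
    rw [e, this, neg_smul, one_smul, add_neg_cancel_right]
  · refine ⟨1, ?_⟩
    have e : symmDiff S {i} = insert i S := by
      ext j; by_cases hj : j = i <;> simp [Finset.mem_symmDiff, hj, hi]
    rw [e, subsetSumPoint_insert hi, one_smul]

theorem even_card_symmDiff_singleton (S : Finset ℕ) (i : ℕ) :
    Even (symmDiff S {i}).card ↔ ¬ Even S.card := by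
  by_cases hi : i ∈ S
  · have e : symmDiff S {i} = S.erase i := by
      ext j; by_cases hj : j = i <;> simp [Finset.mem_symmDiff, hj, hi]
    rw [e, ← Finset.card_erase_add_one hi, Nat.even_add_one, not_not]
  · have e : symmDiff S {i} = insert i S := by
      ext j; by_cases hj : j = i <;> simp [Finset.mem_symmDiff, hj, hi]
    rw [e, Finset.card_insert_of_notMem hi, Nat.even_add_one]

theorem subsetSumPoint_mem_intSet (S : Finset ℕ) (i : Fin 2) : subsetSumPoint S i ∈ intSet := by
  fin_cases i
  · exact ⟨S.card, by simp [subsetSumPoint]⟩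
  · exact ⟨((∑ i ∈ S, 2 ^ i : ℕ) : ℤ), by simp [subsetSumPoint]⟩

/-- Subsets of `range m` are the vertices of an `m`-cube, projected injectively to the lattice.
Toggling the element `i` moves a point along the `i`-th direction and changes parity, so on each
such line it matches the even subsets with the odd ones. -/
theorem switchingSizes_intSet_two_nonempty {m : ℕ} (hm : 2 ≤ m) :
    (switchingSizes intSet 2 m).Nonempty := by
  classical
  have hindep : ∀ i j : ℕ, i ≠ j →
      LinearIndependent ℝ ![![1, (2 : ℝ) ^ i], ![1, (2 : ℝ) ^ j]] := by
    intro i j hij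
    rw [LinearIndependent.pair_iff]
    intro a b h
    have h0 := congrFun h 0
    have h1 := congrFun h 1
    simp at h0 h1
    have hne : (2 : ℝ) ^ i - 2 ^ j ≠ 0 :=
      sub_ne_zero.2 fun e => hij (pow_right_injective₀ (by norm_num) (by norm_num) e)
    have ha : a = 0 := by
      refine (mul_eq_zero.1 (?_ : a * ((2 : ℝ) ^ i - 2 ^ j) = 0)).resolve_right hne
      linear_combination h1 - 2 ^ j * h0
    exact ⟨ha, by linarith⟩
  set E := (Finset.range m).powerset.filter fun S => Even S.card with hE
  set O := (Finset.range m).powerset.filter fun S => ¬ Even S.card with hO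
  have hflip : ∀ i < m, ∀ S, symmDiff S {i} ⊆ Finset.range m ↔ S ⊆ Finset.range m := by
    intro i hi
    have key : ∀ S : Finset ℕ, S ⊆ Finset.range m → symmDiff S {i} ⊆ Finset.range m := by
      intro S hS j hj
      rcases Finset.mem_symmDiff.1 hj with ⟨hj, -⟩ | ⟨hj, -⟩
      · exact hS hj
      · rw [Finset.mem_singleton.1 hj]; exact Finset.mem_range.2 hi
    intro S
    refine ⟨fun h => ?_, key S⟩
    have := key _ h
    rwa [symmDiff_symmDiff_cancel_right] at this
  have hEO : ∀ i < m, ∀ S, symmDiff S {i} ∈ O ↔ S ∈ E := by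
    intro i hi S
    simp only [hE, hO, Finset.mem_filter, Finset.mem_powerset, hflip i hi,
      even_card_symmDiff_singleton, not_not]
  have hinj : ∀ i : ℕ, Function.Injective fun S : Finset ℕ => symmDiff S {i} :=
    fun i => symmDiff_left_injective {i}
  have hcard : O.card = E.card := by
    have : E.image (fun S => symmDiff S {0}) = O := by
      ext S
      simp only [Finset.mem_image]
      constructor
      · rintro ⟨T, hT, rfl⟩
        exact (hEO 0 (by omega) T).2 hT
      · intro hS
        exact ⟨symmDiff S {0}, (hEO 0 (by omega) _).1
          (by rwa [symmDiff_symmDiff_cancel_right]), symmDiff_symmDiff_cancel_right _ _⟩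
    rw [← this, Finset.card_image_of_injective _ (hinj 0)]
  refine ⟨E.card, fun i => ![1, (2 : ℝ) ^ (i : ℕ)], fun i j hij => hindep i j (by
      simpa [Fin.ext_iff] using hij), ?_, E.image subsetSumPoint, O.image subsetSumPoint,
    ?_, ?_, Finset.card_image_of_injective _ subsetSumPoint_injective, ?_, ?_, ?_⟩
  · have h01 := (hindep 0 1 (by norm_num)).span_eq_top_of_card_eq_finrank (by simp)
    rw [eq_top_iff, ← h01, Submodule.span_le]
    rintro _ ⟨k, rfl⟩
    fin_cases k
    · exact Submodule.subset_span ⟨⟨0, by omega⟩, by simp⟩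
    · exact Submodule.subset_span ⟨⟨1, by omega⟩, by simp⟩
  · intro p hp i
    obtain ⟨S, -, rfl⟩ := Finset.mem_image.1 hp
    exact subsetSumPoint_mem_intSet S i
  · intro p hp i
    obtain ⟨S, -, rfl⟩ := Finset.mem_image.1 hp
    exact subsetSumPoint_mem_intSet S i
  · rw [Finset.card_image_of_injective _ subsetSumPoint_injective, hcard]
  · intro e
    have h1 : E = O := Finset.image_injective subsetSumPoint_injective e
    have h2 : (∅ : Finset ℕ) ∈ E := by simp [hE]
    rw [h1] at h2
    simp [hO] at h2
  · intro i
    funext x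
    have hset : ∀ A : Finset (Finset ℕ),
        {p : Fin 2 → ℝ | p ∈ A.image subsetSumPoint ∧
          ∃ t : ℝ, p = x + t • ![1, (2 : ℝ) ^ (i : ℕ)]} =
        subsetSumPoint '' {S | S ∈ A ∧
          ∃ t : ℝ, subsetSumPoint S = x + t • ![1, (2 : ℝ) ^ (i : ℕ)]} := by
      intro A
      ext p
      simp only [Finset.mem_image, Set.mem_ofPred_eq, Set.mem_image]
      constructor
      · rintro ⟨⟨S, hS, rfl⟩, ht⟩
        exact ⟨S, ⟨hS, ht⟩, rfl⟩
      · rintro ⟨S, ⟨hS, ht⟩, rfl⟩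
        exact ⟨⟨S, hS, rfl⟩, ht⟩
    rw [xray, xray, hset, hset, Set.ncard_image_of_injective _ subsetSumPoint_injective,
      Set.ncard_image_of_injective _ subsetSumPoint_injective,
      ← Set.ncard_image_of_injective _ (hinj i)]
    congr 1
    have hline : ∀ S, (∃ t : ℝ, subsetSumPoint S = x + t • ![1, (2 : ℝ) ^ (i : ℕ)]) →
        ∃ t : ℝ, subsetSumPoint (symmDiff S {(i : ℕ)}) = x + t • ![1, (2 : ℝ) ^ (i : ℕ)] := by
      rintro S ⟨t, ht⟩
      obtain ⟨t', ht'⟩ := exists_subsetSumPoint_symmDiff S i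
      exact ⟨t + t', by rw [ht', ht, add_smul, add_assoc]⟩
    ext S
    simp only [Set.mem_image, Set.mem_ofPred_eq]
    constructor
    · rintro ⟨T, ⟨hT, ht⟩, rfl⟩
      exact ⟨(hEO i i.2 T).2 hT, hline T ht⟩
    · rintro ⟨hS, ht⟩
      exact ⟨symmDiff S {(i : ℕ)}, ⟨(hEO i i.2 _).1 (by rwa [symmDiff_symmDiff_cancel_right]),
        hline S ht⟩, symmDiff_symmDiff_cancel_right _ _⟩

theorem theorem2 (m : ℕ) (hm : m = 5 ∨ 6 < m) :
    (switchingSizes intSet 2 m).Nonempty ∧ m + 1 ≤ psi intSet 2 m ∧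
    ∀ n : ℕ, n ≤ m → ∀ s : Fin m → Fin 2 → ℝ, PairwiseIndependent s →
      ∀ F F' : Finset (Fin 2 → ℝ), PointsIn intSet F → PointsIn intSet F' →
        F.card = n → F'.card = n → F ≠ F' → ¬ ∀ i, xray F (s i) = xray F' (s i) := by
  have hne := switchingSizes_intSet_two_nonempty (m := m) (by omega)
  refine ⟨hne, ?_, fun n hn s hs F F' hF hF' hFn hFn' => not_forall_xray_eq hm hn hs hF hF' hFn hFn'⟩
  obtain ⟨s, hs, -, F, F', hF, hF', hFn, hFn', hFF, hx⟩ := Nat.sInf_mem hne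
  by_contra hlt
  exact not_forall_xray_eq hm (Nat.lt_succ_iff.1 (not_le.1 hlt)) hs hF hF' hFn hFn' hFF hx
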